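/- All rectangles are nondegenerate and have sides parallel to the coordinate axes; the ratio of a rectangle is the length of its horizontal side divided by the length of its vertical side. A rectangle is tiled by finitely many rectangles if they cover exactly it and have pairwise disjoint interiors. An algebraic conjugate of an algebraic number $c$ is a complex root of the minimal polynomial of $c$ over $\mathbb{Q}$ (the number $c$ itself included). Theorem. For every real number $c>0$ the following three conditions are equivalent. (1) A square can be tiled by finitely many rectangles, each of which has ratio $c$ or $1/c$. (2) The number $c$ is algebraic and all its algebraic conjugates have positive real parts. (3) For some $m\ge 1$ and some positive rational numbers $d_1,\dots,d_m$ we have $$d_1c+\cfrac{1}{d_2c+\cdots+\cfrac{1}{d_mc}}=1.$$ -/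

import Mathlib

/-- A nondegenerate rectangle in the plane with sides parallel to the coordinate axes. -/
@[ext]
structure Rect where
  left : ℝ
  right : ℝ
  bottom : ℝ
  top : ℝ
  left_lt_right : left < right
  bottom_lt_top : bottom < top

namespace Rect

/-- The closed set of points of the plane that the rectangle occupies. -/
def toSet (R : Rect) : Set (ℝ × ℝ) :=
  Set.Icc R.left R.right ×ˢ Set.Icc R.bottom R.top

/-- The length of the horizontal side divided by the length of the vertical side. -/
noncomputable def ratio (R : Rect) : ℝ :=
  (R.right - R.left) / (R.top - R.bottom)

/-- A square is a rectangle whose horizontal and vertical sides have equal length. -/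
def IsSquare (R : Rect) : Prop :=
  R.right - R.left = R.top - R.bottom

/-- The finite collection `T` of rectangles tiles `R`: the rectangles of `T` cover exactly `R`
and have pairwise disjoint interiors. -/
def IsTiling (R : Rect) (T : Finset Rect) : Prop :=
  (⋃ t ∈ T, t.toSet) = R.toSet ∧
    (T : Set Rect).PairwiseDisjoint (fun t => interior t.toSet)

/-- `R` can be tiled by finitely many rectangles, each with ratio in `C`. -/
def CanBeTiledByRatios (R : Rect) (C : Set ℝ) : Prop :=
  ∃ T : Finset Rect, R.IsTiling T ∧ ∀ t ∈ T, t.ratio ∈ C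

end Rect

/-- For `[d₁, …, dₘ]` with `m ≥ 1`, the continued fraction
`d₁ c + 1 / (d₂ c + ⋯ + 1 / (dₘ c))`. -/
noncomputable def contFrac (c : ℝ) : List ℚ → ℝ
  | [] => 0
  | [d] => d * c
  | d :: e :: l => d * c + 1 / contFrac c (e :: l)

/-!
From a tiling to the conjugates of `c`: for any two functions `f` and `g` on the line, the increment
of `f` along the horizontal side times the increment of `g` along the vertical side is additive over
tilings (`Rect.IsTiling.sum_mul_increment`). Let `σ` embed `ℚ(c)` into `ℂ`, let `f : ℝ → ℂ` be
`σ`-semilinear with value `1` at the side of the tiled square, and let `g` be its complex conjugate.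
A tile of ratio `c` contributes `σ(c)` times a square of an absolute value, a tile of ratio `1 / c`
contributes the conjugate of `σ(c)` times such a square, and the square contributes `1`. Taking real
parts gives `0 < re σ(c)` (`Rect.re_pos_of_isTiling`). If `c` were transcendental, `σ` could send `c`
to `-c`, so `c` is algebraic, and then every conjugate is some `σ(c)`.

From the conjugates to the continued fraction: let `Q` be the monic polynomial whose roots are the
negatives of the conjugates of `c`, and write `Q = A + B` with `A` of the parity of `deg Q` and `B`
of the opposite parity. The minimal polynomial is `A - B`, so `A(c) / B(c) = 1`. All roots of `Q`
lie in the left half-plane, so `A / B` has positive real part in the right half-plane. For the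
positive `d` that makes the degree of `R = A - d * X * B` drop, a minimum principle of
Phragmén–Lindelöf type shows that `B + R` has all its roots in the left half-plane as well
(`Polynomial.IsHurwitz.add_sub_mul`). Hence the Euclidean algorithm expands `A / B` into a continued
fraction with positive rational coefficients (`Polynomial.IsHurwitz.exists_contFrac`).

From the continued fraction to a tiling: the set of ratios `r` such that every rectangle of ratio
`r` can be tiled is closed under addition (put rectangles side by side) and inversion (reflect in
the diagonal), and it contains `c`. It therefore contains all positive rational multiples of `c`,
and the value `1` of the continued fraction.
-/

/-! ### Sums over tilings -/

/-- Of all points of a finite set containing the endpoints `a` and `b`, only these two have their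
neighbours `x - ε` and `x + ε` on different sides of the boundary of the interval `(a, b)`. -/
theorem sum_mul_jump {X : Finset ℝ} {a b ε : ℝ} (ha : a ∈ X) (hb : b ∈ X) (hab : a < b)
    (hε : 0 < ε) (hX : ∀ x ∈ X, ∀ y ∈ X, x < y → ε < y - x) (f : ℝ → ℂ) :
    ∑ x ∈ X, f x * ((Set.Ioo a b).indicator 1 (x - ε) - (Set.Ioo a b).indicator 1 (x + ε)) =
      f b - f a := by
  have key : ∀ x ∈ X,
      f x * ((Set.Ioo a b).indicator 1 (x - ε) - (Set.Ioo a b).indicator 1 (x + ε)) =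
        (if x = b then f x else 0) - (if x = a then f x else 0) := by
    intro x hx
    have e1 : x - ε ∈ Set.Ioo a b ↔ a < x ∧ x ≤ b := by
      constructor
      · rintro ⟨h1, h2⟩
        refine ⟨by linarith, not_lt.1 fun h => ?_⟩
        linarith [hX b hb x hx h]
      · rintro ⟨h1, h2⟩
        exact ⟨by linarith [hX a ha x hx h1], by linarith⟩
    have e2 : x + ε ∈ Set.Ioo a b ↔ a ≤ x ∧ x < b := by
      constructor
      · rintro ⟨h1, h2⟩
        refine ⟨not_lt.1 fun h => ?_, by linarith⟩
        linarith [hX x hx a ha h]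
      · rintro ⟨h1, h2⟩
        exact ⟨by linarith, by linarith [hX x hx b hb h2]⟩
    simp only [Set.indicator_apply, e1, e2, Pi.one_apply]
    rcases lt_trichotomy x a with h | h | h
    · simp [h.not_gt, h.not_ge, h.ne, (h.trans hab).ne]
    · subst h; simp [hab, hab.ne]
    · rcases lt_trichotomy x b with h' | h' | h'
      · simp [h, h.le, h', h'.le, h.ne', h'.ne]
      · subst h'; simp [h, h.ne']
      · simp [h'.not_ge, h'.not_gt, h.ne', h'.ne']
  rw [Finset.sum_congr rfl key, Finset.sum_sub_distrib, Finset.sum_ite_eq', Finset.sum_ite_eq']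
  simp [ha, hb]

namespace Rect

/-- The four coordinates of the sides of a rectangle. -/
noncomputable def coords (R : Rect) : Finset ℝ := {R.left, R.right, R.bottom, R.top}

theorem interior_toSet (R : Rect) :
    interior R.toSet = Set.Ioo R.left R.right ×ˢ Set.Ioo R.bottom R.top := by
  rw [toSet, interior_prod_eq, interior_Icc, interior_Icc]

theorem mem_interior_iff_mem_toSet {R : Rect} {p : ℝ × ℝ} (h₁ : p.1 ∉ R.coords)
    (h₂ : p.2 ∉ R.coords) : p ∈ interior R.toSet ↔ p ∈ R.toSet := by
  refine ⟨fun h => interior_subset h, fun h => ?_⟩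
  rw [interior_toSet]
  simp only [coords, Finset.mem_insert, Finset.mem_singleton, not_or] at h₁ h₂
  obtain ⟨⟨a, b⟩, c, d⟩ := h
  exact ⟨⟨lt_of_le_of_ne a (Ne.symm h₁.1), lt_of_le_of_ne b h₁.2.1⟩,
    lt_of_le_of_ne c (Ne.symm h₂.2.2.1), lt_of_le_of_ne d h₂.2.2.2⟩

/-- The indicator functions of the open tiles add up to that of the open tiled rectangle, away
from the lines that carry the sides. -/
theorem IsTiling.sum_indicator {R : Rect} {T : Finset Rect} (h : R.IsTiling T) {X : Finset ℝ}
    (hR : R.coords ⊆ X) (hT : ∀ t ∈ T, t.coords ⊆ X) {u v : ℝ} (hu : u ∉ X) (hv : v ∉ X) :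
    ∑ t ∈ T, (Set.Ioo t.left t.right).indicator (1 : ℝ → ℂ) u *
        (Set.Ioo t.bottom t.top).indicator (1 : ℝ → ℂ) v =
      (Set.Ioo R.left R.right).indicator (1 : ℝ → ℂ) u *
        (Set.Ioo R.bottom R.top).indicator (1 : ℝ → ℂ) v := by
  classical
  have e : ∀ t : Rect, (Set.Ioo t.left t.right).indicator (1 : ℝ → ℂ) u *
        (Set.Ioo t.bottom t.top).indicator (1 : ℝ → ℂ) v =
      if (u, v) ∈ interior t.toSet then 1 else 0 := by
    intro t
    rw [interior_toSet]
    simp only [Set.indicator_apply, Set.mem_prod, Pi.one_apply, ite_and, mul_ite, mul_one, mul_zero]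
    split_ifs <;> rfl
  simp only [e]
  have hRiff : (u, v) ∈ interior R.toSet ↔ (u, v) ∈ R.toSet :=
    mem_interior_iff_mem_toSet (fun h => hu (hR h)) (fun h => hv (hR h))
  have hTiff : ∀ t ∈ T, ((u, v) ∈ interior t.toSet ↔ (u, v) ∈ t.toSet) := fun t ht =>
    mem_interior_iff_mem_toSet (fun h => hu (hT t ht h)) (fun h => hv (hT t ht h))
  by_cases hm : (u, v) ∈ R.toSet
  · rw [if_pos (hRiff.2 hm)]
    have hm' := hm
    rw [← h.1, Set.mem_iUnion₂] at hm'
    obtain ⟨t, ht, htm⟩ := hm'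
    have htm' := (hTiff t ht).2 htm
    rw [Finset.sum_eq_single_of_mem t ht, if_pos htm']
    intro s hs hst
    exact if_neg fun hs' => Set.disjoint_left.1 (h.2 hs ht hst) hs' htm'
  · rw [if_neg (mt hRiff.1 hm)]
    refine Finset.sum_eq_zero fun t ht => if_neg fun htm => hm ?_
    rw [← h.1]
    exact Set.mem_iUnion₂.2 ⟨t, ht, interior_subset htm⟩

/-- For arbitrary functions `f` and `g`, the increment of `f` along the horizontal side times the
increment of `g` along the vertical side is additive over tilings. -/
theorem IsTiling.sum_mul_increment {R : Rect} {T : Finset Rect} (h : R.IsTiling T)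
    (f g : ℝ → ℂ) :
    ∑ t ∈ T, (f t.right - f t.left) * (g t.top - g t.bottom) =
      (f R.right - f R.left) * (g R.top - g R.bottom) := by
  classical
  set X : Finset ℝ := R.coords ∪ T.biUnion coords with hXdef
  have hR : R.coords ⊆ X := Finset.subset_union_left
  have hT : ∀ t ∈ T, t.coords ⊆ X := fun t ht =>
    (Finset.subset_biUnion_of_mem coords ht).trans Finset.subset_union_right
  obtain ⟨ε, hε, hX⟩ : ∃ ε : ℝ, 0 < ε ∧ ∀ x ∈ X, ∀ y ∈ X, x < y → ε < y - x := by
    have : ∀ᶠ ε : ℝ in nhdsWithin 0 (Set.Ioi 0), ∀ x ∈ X, ∀ y ∈ X, x < y → ε < y - x := by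
      refine (Finset.eventually_all X).2 fun x _ => (Finset.eventually_all X).2 fun y _ => ?_
      by_cases hxy : x < y
      · filter_upwards [nhdsWithin_le_nhds (Iio_mem_nhds (sub_pos.2 hxy))] with ε hε _ using hε
      · exact Filter.Eventually.of_forall fun _ h => absurd h hxy
    exact ((eventually_mem_nhdsWithin (a := (0 : ℝ)) (s := Set.Ioi 0)).and this).exists
  have hsub : ∀ x ∈ X, x - ε ∉ X := fun x hx hx' => by
    linarith [hX _ hx' _ hx (by linarith)]
  have hadd : ∀ x ∈ X, x + ε ∉ X := fun x hx hx' => by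
    linarith [hX _ hx _ hx' (by linarith)]
  have key : ∀ t : Rect, t.coords ⊆ X →
      (f t.right - f t.left) * (g t.top - g t.bottom) = ∑ x ∈ X, ∑ y ∈ X, f x * g y *
        (((Set.Ioo t.left t.right).indicator 1 (x - ε) *
            (Set.Ioo t.bottom t.top).indicator 1 (y - ε) -
          (Set.Ioo t.left t.right).indicator 1 (x - ε) *
            (Set.Ioo t.bottom t.top).indicator 1 (y + ε)) -
        ((Set.Ioo t.left t.right).indicator 1 (x + ε) *
            (Set.Ioo t.bottom t.top).indicator 1 (y - ε) -
          (Set.Ioo t.left t.right).indicator 1 (x + ε) *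
            (Set.Ioo t.bottom t.top).indicator 1 (y + ε))) := by
    intro t ht
    rw [← sum_mul_jump (ht (by simp [coords])) (ht (by simp [coords])) t.left_lt_right hε hX f,
      ← sum_mul_jump (ht (by simp [coords])) (ht (by simp [coords])) t.bottom_lt_top hε hX g,
      Finset.sum_mul_sum]
    refine Finset.sum_congr rfl fun x _ => Finset.sum_congr rfl fun y _ => ?_
    ring
  rw [key R hR, Finset.sum_congr rfl fun t ht => key t (hT t ht), Finset.sum_comm]
  refine Finset.sum_congr rfl fun x hx => ?_
  rw [Finset.sum_comm]
  refine Finset.sum_congr rfl fun y hy => ?_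
  rw [← Finset.mul_sum, Finset.sum_sub_distrib, Finset.sum_sub_distrib, Finset.sum_sub_distrib,
    h.sum_indicator hR hT (hsub x hx) (hsub y hy), h.sum_indicator hR hT (hsub x hx) (hadd y hy),
    h.sum_indicator hR hT (hadd x hx) (hsub y hy), h.sum_indicator hR hT (hadd x hx) (hadd y hy)]

/-! ### Conjugates of the ratio of the tiles of a square -/

theorem height_pos (R : Rect) : 0 < R.top - R.bottom := sub_pos.2 R.bottom_lt_top

theorem width_pos (R : Rect) : 0 < R.right - R.left := sub_pos.2 R.left_lt_right

/-- If a square is tiled by rectangles of ratios `c` and `1 / c`, then every embedding into `ℂ` of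
a subfield of `ℝ` containing `c` maps `c` into the open right half-plane. -/
theorem re_pos_of_isTiling {c : ℝ} (hc : 0 < c) {S : Rect} (hS : S.IsSquare)
    (hT : S.CanBeTiledByRatios {c, 1 / c}) (K : IntermediateField ℚ ℝ) (hcK : c ∈ K)
    (σ : K →+* ℂ) : 0 < (σ ⟨c, hcK⟩).re := by
  obtain ⟨T, hT, hr⟩ := hT
  set z := σ ⟨c, hcK⟩ with hz
  -- A `σ`-semilinear map `F : ℝ → ℂ` which does not vanish at the side of the square.
  obtain ⟨φ, -, hφ⟩ := LinearMap.exists_extend_of_notMem (K := K) (V := ℝ) (V' := K)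
    (p := ⊥) 0 (v := S.right - S.left) (by simpa using (S.width_pos).ne') 1
  set F : ℝ → ℂ := fun x => σ (φ x) with hF
  have hFsub : ∀ x y, F x - F y = F (x - y) := fun x y => by simp [hF]
  have hFmul : ∀ x, F (c * x) = z * F x := fun x => by
    have : c * x = (⟨c, hcK⟩ : K) • x := rfl
    simp only [hF]
    rw [this, map_smul, smul_eq_mul, map_mul]
  have hsum := hT.sum_mul_increment F (fun x => starRingEnd ℂ (F x))
  have hS1 : F (S.right - S.left) = 1 := by simp [hF, hφ]
  have hS2 : F (S.top - S.bottom) = 1 := by rw [← hS, hS1]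
  simp only [← map_sub, hFsub, hS1, hS2, map_one, mul_one] at hsum
  have hre : 1 = z.re * ∑ t ∈ T, (if t.ratio = c then Complex.normSq (F (t.top - t.bottom))
      else Complex.normSq (F (t.right - t.left))) := by
    rw [← Complex.one_re, ← hsum, Complex.re_sum, Finset.mul_sum]
    refine Finset.sum_congr rfl fun t ht => ?_
    split_ifs with hcase
    · have : t.right - t.left = c * (t.top - t.bottom) := by
        rw [← hcase, ratio, div_mul_cancel₀ _ t.height_pos.ne']
      rw [this, hFmul, mul_assoc, Complex.mul_conj, Complex.re_mul_ofReal]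
    · have h2 : t.ratio = 1 / c := (hr t ht).resolve_left hcase
      have : t.top - t.bottom = c * (t.right - t.left) := by
        rw [ratio, div_eq_div_iff t.height_pos.ne' hc.ne'] at h2
        linarith
      rw [this, hFmul, map_mul, mul_left_comm, Complex.mul_conj, Complex.re_mul_ofReal,
        Complex.conj_re]
  by_contra hneg
  have hnn : 0 ≤ ∑ t ∈ T, (if t.ratio = c then Complex.normSq (F (t.top - t.bottom))
      else Complex.normSq (F (t.right - t.left))) :=
    Finset.sum_nonneg fun t _ => by split_ifs <;> exact Complex.normSq_nonneg _
  have := mul_nonpos_of_nonpos_of_nonneg (not_lt.1 hneg) hnn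
  linarith

open IntermediateField in
theorem _root_.exists_algEquiv_adjoin_of_transcendental {k L : Type*} [Field k] [Field L]
    [Algebra k L] {x y : L} (hx : Transcendental k x) (hy : Transcendental k y) :
    ∃ e : k⟮x⟯ ≃ₐ[k] k⟮y⟯, e (AdjoinSimple.gen k x) = AdjoinSimple.gen k y := by
  refine ⟨(RatFunc.algEquivOfTranscendental x hx).symm.trans
    (RatFunc.algEquivOfTranscendental y hy), ?_⟩
  have e : (RatFunc.algEquivOfTranscendental x hx).symm (AdjoinSimple.gen k x) = RatFunc.X := by
    rw [AlgEquiv.symm_apply_eq]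
    exact Subtype.ext (RatFunc.algEquivOfTranscendental_X x hx).symm
  rw [AlgEquiv.trans_apply, e]
  exact Subtype.ext (RatFunc.algEquivOfTranscendental_X y hy)

open IntermediateField in
theorem isAlgebraic_of_isTiling {c : ℝ} (hc : 0 < c) {S : Rect} (hS : S.IsSquare)
    (hT : S.CanBeTiledByRatios {c, 1 / c}) : IsAlgebraic ℚ c := by
  by_contra htr
  have htr' : Transcendental ℚ (-c) := fun h => htr (by simpa using h.neg)
  -- The field `ℚ(c)` has an embedding with `c ↦ -c`.
  obtain ⟨e, he⟩ := exists_algEquiv_adjoin_of_transcendental htr htr'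
  have h := re_pos_of_isTiling hc hS hT ℚ⟮c⟯ (mem_adjoin_simple_self ℚ c)
    (((algebraMap ℝ ℂ).comp (algebraMap ℚ⟮-c⟯ ℝ)).comp e.toRingEquiv.toRingHom)
  have he' : ((e ⟨c, mem_adjoin_simple_self ℚ c⟩ : ℚ⟮-c⟯) : ℝ) = -c := congrArg Subtype.val he
  have h' : (0 : ℝ) < ((e ⟨c, mem_adjoin_simple_self ℚ c⟩ : ℚ⟮-c⟯) : ℝ) := h
  linarith

open IntermediateField in
theorem re_pos_of_aeval_minpoly_eq_zero {c : ℝ} (hc : 0 < c) {S : Rect} (hS : S.IsSquare)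
    (hT : S.CanBeTiledByRatios {c, 1 / c}) {z : ℂ}
    (hz : Polynomial.aeval z (minpoly ℚ c) = 0) : 0 < z.re := by
  have hint : IsIntegral ℚ c := (isAlgebraic_of_isTiling hc hS hT).isIntegral
  have := re_pos_of_isTiling hc hS hT ℚ⟮c⟯ (mem_adjoin_simple_self ℚ c)
    ((algHomAdjoinIntegralEquiv ℚ hint).symm
      ⟨z, Polynomial.mem_aroots.2 ⟨minpoly.ne_zero hint, hz⟩⟩ : ℚ⟮c⟯ →ₐ[ℚ] ℂ).toRingHom
  have e := algHomAdjoinIntegralEquiv_symm_apply_gen ℚ hint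
      ⟨z, Polynomial.mem_aroots.2 ⟨minpoly.ne_zero hint, hz⟩⟩
  have e' : 0 < (((algHomAdjoinIntegralEquiv ℚ hint).symm
      ⟨z, Polynomial.mem_aroots.2 ⟨minpoly.ne_zero hint, hz⟩⟩) (AdjoinSimple.gen ℚ c)).re := this
  rwa [e] at e'

/-! ### Ratios of rectangles that can be tiled -/

/-- Reflection in the diagonal. -/
def swap (R : Rect) : Rect :=
  ⟨R.bottom, R.top, R.left, R.right, R.bottom_lt_top, R.left_lt_right⟩

@[simp] theorem swap_swap (R : Rect) : R.swap.swap = R := rfl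

theorem mem_toSet_swap {R : Rect} {p : ℝ × ℝ} : p ∈ R.swap.toSet ↔ p.swap ∈ R.toSet := by
  simp [toSet, swap]

theorem mem_interior_toSet_swap {R : Rect} {p : ℝ × ℝ} :
    p ∈ interior R.swap.toSet ↔ p.swap ∈ interior R.toSet := by
  simp [interior_toSet, swap, and_comm]

theorem ratio_swap (R : Rect) : R.swap.ratio = (R.ratio)⁻¹ := by
  simp [ratio, swap]

theorem CanBeTiledByRatios.swap {R : Rect} {C : Set ℝ} (hC : ∀ x ∈ C, x⁻¹ ∈ C)
    (h : R.CanBeTiledByRatios C) : R.swap.CanBeTiledByRatios C := by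
  classical
  obtain ⟨T, ⟨hU, hD⟩, hr⟩ := h
  refine ⟨T.image Rect.swap, ⟨?_, ?_⟩, ?_⟩
  · ext p
    have := Set.ext_iff.1 hU p.swap
    simpa [mem_toSet_swap] using this
  · intro s hs t ht hst
    simp only [Finset.coe_image, Set.mem_image, Finset.mem_coe] at hs ht
    obtain ⟨s, hs, rfl⟩ := hs
    obtain ⟨t, ht, rfl⟩ := ht
    refine Set.disjoint_left.2 fun p hp hq => ?_
    exact Set.disjoint_left.1 (hD hs ht fun h => hst (by rw [h]))
      (mem_interior_toSet_swap.1 hp) (mem_interior_toSet_swap.1 hq)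
  · simp only [Finset.mem_image, forall_exists_index, and_imp, forall_apply_eq_imp_iff₂, ratio_swap]
    exact fun t ht => hC _ (hr t ht)

/-- Tilings of two rectangles that are side by side join to a tiling of their union. -/
theorem CanBeTiledByRatios.of_split {R : Rect} {C : Set ℝ} {m : ℝ} (h₁ : R.left < m)
    (h₂ : m < R.right)
    (hl : (Rect.mk R.left m R.bottom R.top h₁ R.bottom_lt_top).CanBeTiledByRatios C)
    (hr : (Rect.mk m R.right R.bottom R.top h₂ R.bottom_lt_top).CanBeTiledByRatios C) :
    R.CanBeTiledByRatios C := by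
  classical
  obtain ⟨T₁, ⟨hU₁, hD₁⟩, hr₁⟩ := hl
  obtain ⟨T₂, ⟨hU₂, hD₂⟩, hr₂⟩ := hr
  have hcross : ∀ s ∈ T₁, ∀ t ∈ T₂, Disjoint (interior s.toSet) (interior t.toSet) := by
    intro s hs t ht
    have i₁ := interior_mono (hU₁ ▸ Set.subset_biUnion_of_mem (u := toSet) hs)
    have i₂ := interior_mono (hU₂ ▸ Set.subset_biUnion_of_mem (u := toSet) ht)
    refine Set.disjoint_left.2 fun p hp hq => ?_
    have j₁ := i₁ hp
    have j₂ := i₂ hq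
    rw [interior_toSet] at j₁ j₂
    exact lt_asymm j₁.1.2 j₂.1.1
  refine ⟨T₁ ∪ T₂, ⟨?_, ?_⟩, ?_⟩
  · rw [Finset.set_biUnion_union, hU₁, hU₂]
    simp only [toSet]
    rw [← Set.union_prod, Set.Icc_union_Icc_eq_Icc h₁.le h₂.le]
  · intro s hs t ht hst
    simp only [Finset.coe_union, Set.mem_union, Finset.mem_coe] at hs ht
    rcases hs with hs | hs <;> rcases ht with ht | ht
    · exact hD₁ hs ht hst
    · exact hcross s hs t ht
    · exact (hcross t ht s hs).symm
    · exact hD₂ hs ht hst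
  · intro t ht
    rcases Finset.mem_union.1 ht with ht | ht
    exacts [hr₁ t ht, hr₂ t ht]

/-- All rectangles of ratio `r` can be tiled by rectangles with ratios in `C`. -/
def IsTileableRatio (C : Set ℝ) (r : ℝ) : Prop :=
  0 < r ∧ ∀ R : Rect, R.ratio = r → R.CanBeTiledByRatios C

variable {C : Set ℝ} {r s : ℝ}

theorem IsTileableRatio.of_mem (hr : 0 < r) (h : r ∈ C) : IsTileableRatio C r :=
  ⟨hr, fun R hR => ⟨{R}, ⟨by simp, by simp⟩, by simpa [hR] using h⟩⟩

theorem IsTileableRatio.inv (hC : ∀ x ∈ C, x⁻¹ ∈ C) (h : IsTileableRatio C r) :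
    IsTileableRatio C r⁻¹ :=
  ⟨inv_pos.2 h.1, fun R hR => by
    rw [← swap_swap R]
    exact (h.2 R.swap (by rw [ratio_swap, hR, inv_inv])).swap hC⟩

theorem IsTileableRatio.add (hr : IsTileableRatio C r) (hs : IsTileableRatio C s) :
    IsTileableRatio C (r + s) := by
  refine ⟨add_pos hr.1 hs.1, fun R hR => ?_⟩
  have hH := R.height_pos
  rw [ratio, div_eq_iff hH.ne'] at hR
  have p₁ := mul_pos hr.1 hH
  have p₂ := mul_pos hs.1 hH
  refine .of_split (m := R.left + r * (R.top - R.bottom)) (by linarith) (by linarith)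
    (hr.2 _ ?_) (hs.2 _ ?_)
  · simp only [ratio]
    rw [div_eq_iff hH.ne']
    ring
  · simp only [ratio]
    rw [div_eq_iff hH.ne']
    linarith

theorem IsTileableRatio.natCast_mul (h : IsTileableRatio C r) {n : ℕ} (hn : 0 < n) :
    IsTileableRatio C (n * r) := by
  induction n, hn using Nat.le_induction with
  | base => simpa using h
  | succ k _ ih =>
    push_cast
    rw [add_mul, one_mul]
    exact ih.add h

theorem IsTileableRatio.ratCast_mul (hC : ∀ x ∈ C, x⁻¹ ∈ C) (h : IsTileableRatio C r) {q : ℚ}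
    (hq : 0 < q) : IsTileableRatio C (q * r) := by
  have h₁ := (((h.inv hC).natCast_mul q.den_pos).inv hC).natCast_mul
    (Int.natAbs_pos.2 (Rat.num_pos.2 hq).ne')
  convert h₁ using 1
  have h₂ : ((q.num.natAbs : ℕ) : ℝ) = (q.num : ℝ) := by
    rw [Nat.cast_natAbs, abs_of_pos (Rat.num_pos.2 hq)]
  rw [h₂, mul_inv, inv_inv, ← mul_assoc, ← div_eq_mul_inv, ← Rat.cast_def]

theorem IsTileableRatio.contFrac {c : ℝ} (hC : ∀ x ∈ C, x⁻¹ ∈ C) (h : IsTileableRatio C c) :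
    ∀ {d : List ℚ}, d ≠ [] → (∀ q ∈ d, 0 < q) → IsTileableRatio C (contFrac c d)
  | [], h, _ => absurd rfl h
  | [q], _, hd => h.ratCast_mul hC (hd q (by simp))
  | q :: e :: l, _, hd => by
    rw [_root_.contFrac, one_div]
    exact (h.ratCast_mul hC (hd q (by simp))).add
      ((IsTileableRatio.contFrac hC h (List.cons_ne_nil e l)
        fun x hx => hd x (List.mem_cons_of_mem _ hx)).inv hC)

theorem exists_isSquare_canBeTiledByRatios {c : ℝ} (hc : 0 < c) {d : List ℚ} (hd : d ≠ [])
    (hpos : ∀ q ∈ d, 0 < q) (h : _root_.contFrac c d = 1) :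
    ∃ S : Rect, S.IsSquare ∧ S.CanBeTiledByRatios {c, 1 / c} := by
  have hC : ∀ x ∈ ({c, 1 / c} : Set ℝ), x⁻¹ ∈ ({c, 1 / c} : Set ℝ) := by
    rintro x (rfl | rfl) <;> simp
  have ht := (IsTileableRatio.of_mem hc (Set.mem_insert c {1 / c})).contFrac hC hd hpos
  rw [h] at ht
  exact ⟨⟨0, 1, 0, 1, one_pos, one_pos⟩, rfl, ht.2 _ (by simp [ratio])⟩

end Rect

/-! ### Polynomials with all roots in the left half-plane -/

namespace Polynomial

/-- A polynomial with rational coefficients is a *Hurwitz polynomial* if all its complex roots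
have negative real parts. -/
def IsHurwitz (Q : ℚ[X]) : Prop :=
  ∀ z : ℂ, aeval z Q = 0 → z.re < 0

theorem aeval_conj_rat (Q : ℚ[X]) (z : ℂ) :
    aeval (starRingEnd ℂ z) Q = starRingEnd ℂ (aeval z Q) :=
  aeval_algHom_apply (Complex.conjAe.toAlgHom.restrictScalars ℚ) z Q

theorem aeval_neg_of_comp_neg_X {A : ℚ[X]} {n : ℕ} (hA : A.comp (-X) = (-1) ^ n * A) (z : ℂ) :
    aeval (-z) A = (-1) ^ n * aeval z A := by
  have := congrArg (aeval z) hA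
  simpa [aeval_comp] using this

theorem coeff_comp_neg_X (A : ℚ[X]) (k : ℕ) : (A.comp (-X)).coeff k = (-1) ^ k * A.coeff k := by
  rw [show (-X : ℚ[X]) = C (-1) * X by simp, comp_C_mul_X_coeff, mul_comm]

theorem coeff_eq_zero_of_comp_neg_X {A : ℚ[X]} {n : ℕ} (hA : A.comp (-X) = (-1) ^ (n + 1) * A) :
    A.coeff n = 0 := by
  have h := congrArg (fun p => coeff p n) hA
  have h1 : ((-1 : ℚ[X]) ^ (n + 1) * A).coeff n = (-1) ^ (n + 1) * A.coeff n := by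
    rw [show (-1 : ℚ[X]) ^ (n + 1) = C ((-1) ^ (n + 1)) by simp, coeff_C_mul]
  simp only [h1, coeff_comp_neg_X] at h
  rcases neg_one_pow_eq_or ℚ n with e | e <;> rw [pow_succ, e] at h <;> linarith

theorem IsHurwitz.re_lt_zero_of_mem_aroots {Q : ℚ[X]} (hQ : Q.IsHurwitz) {r : ℂ}
    (hr : r ∈ Q.aroots ℂ) : r.re < 0 :=
  hQ r (mem_aroots.1 hr).2

theorem aroots_ne_zero_of_natDegree_pos {Q : ℚ[X]} (hn : 0 < Q.natDegree) : Q.aroots ℂ ≠ 0 := by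
  rw [← Multiset.card_pos, ← (IsAlgClosed.splits (Q.map (algebraMap ℚ ℂ))).natDegree_eq_card_roots,
    natDegree_map]
  exact hn

theorem norm_neg_conj_sub_lt {z r : ℂ} (hz : 0 < z.re) (hr : r.re < 0) :
    ‖-(starRingEnd ℂ z) - r‖ < ‖z - r‖ := by
  rw [← sq_lt_sq₀ (norm_nonneg _) (norm_nonneg _), Complex.sq_norm, Complex.sq_norm,
    Complex.normSq_apply, Complex.normSq_apply]
  simp
  nlinarith

theorem norm_prod_neg_conj_sub_le {z : ℂ} (hz : 0 < z.re) (s : Multiset ℂ)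
    (hs : ∀ r ∈ s, r.re < 0) :
    ‖(s.map fun r => -(starRingEnd ℂ z) - r).prod‖ ≤ ‖(s.map fun r => z - r).prod‖ := by
  induction s using Multiset.induction_on with
  | empty => simp
  | cons a s ih =>
    simp only [Multiset.map_cons, Multiset.prod_cons, norm_mul]
    exact mul_le_mul (norm_neg_conj_sub_lt hz (hs a (by simp))).le
      (ih fun r hr => hs r (by simp [hr])) (norm_nonneg _) (norm_nonneg _)

theorem norm_prod_neg_conj_sub_lt {z : ℂ} (hz : 0 < z.re) {s : Multiset ℂ} (h0 : s ≠ 0)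
    (hs : ∀ r ∈ s, r.re < 0) :
    ‖(s.map fun r => -(starRingEnd ℂ z) - r).prod‖ < ‖(s.map fun r => z - r).prod‖ := by
  obtain ⟨a, ha⟩ := Multiset.exists_mem_of_ne_zero h0
  obtain ⟨t, rfl⟩ := Multiset.exists_cons_of_mem ha
  simp only [Multiset.map_cons, Multiset.prod_cons, norm_mul]
  have ht : ∀ r ∈ t, r.re < 0 := fun r hr => hs r (by simp [hr])
  refine mul_lt_mul_of_lt_of_le_of_nonneg_of_pos (norm_neg_conj_sub_lt hz (hs a ha))
    (norm_prod_neg_conj_sub_le hz t ht) (norm_nonneg _) (norm_pos_iff.2 ?_)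
  refine Multiset.prod_ne_zero fun h => ?_
  obtain ⟨r, hr, hr'⟩ := Multiset.mem_map.1 h
  have := ht r hr
  rw [← sub_eq_zero.1 hr'] at this
  linarith

/-- The values of a Hurwitz polynomial are larger in the right half-plane than at the mirror
images, because each root is closer to the mirror image. -/
theorem IsHurwitz.norm_aeval_neg_lt {Q : ℚ[X]} (hQ : Q.IsHurwitz) (hn : 0 < Q.natDegree) {z : ℂ}
    (hz : 0 < z.re) : ‖aeval (-z) Q‖ < ‖aeval z Q‖ := by
  have e : ‖aeval (-z) Q‖ = ‖aeval (-(starRingEnd ℂ z)) Q‖ := by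
    rw [← map_neg, aeval_conj_rat, RCLike.norm_conj]
  have hs := IsAlgClosed.splits (Q.map (algebraMap ℚ ℂ))
  have f : ∀ w : ℂ, aeval w Q = algebraMap ℚ ℂ Q.leadingCoeff *
      ((Q.aroots ℂ).map fun r => w - r).prod := fun w => hs.aeval_eq_prod_aroots w
  rw [e, f, f, norm_mul, norm_mul]
  have hl : 0 < ‖algebraMap ℚ ℂ Q.leadingCoeff‖ := by
    rw [norm_pos_iff, _root_.map_ne_zero, leadingCoeff_ne_zero]
    rintro rfl
    simp at hn
  exact mul_lt_mul_of_pos_left (norm_prod_neg_conj_sub_lt hz (aroots_ne_zero_of_natDegree_pos hn)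
    fun r hr => hQ.re_lt_zero_of_mem_aroots hr) hl

/-- The second coefficient is `-1` times the leading one times the sum of the roots. -/
theorem IsHurwitz.coeff_pos {Q : ℚ[X]} (hQ : Q.IsHurwitz) {n : ℕ} (hn : Q.natDegree = n + 1)
    (hl : 0 < Q.coeff (n + 1)) : 0 < Q.coeff n := by
  have hs := IsAlgClosed.splits (Q.map (algebraMap ℚ ℂ))
  have h := hs.nextCoeff_eq_neg_sum_roots_mul_leadingCoeff
  have hsum : ∀ s : Multiset ℂ, s ≠ 0 → (∀ r ∈ s, r.re < 0) → s.sum.re < 0 := by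
    intro s hs0 hs
    induction s using Multiset.induction_on with
    | empty => exact absurd rfl hs0
    | cons a s ih =>
      rw [Multiset.sum_cons, Complex.add_re]
      have ha := hs a (by simp)
      rcases eq_or_ne s 0 with rfl | h0
      · simpa using ha
      · linarith [ih h0 fun r hr => hs r (by simp [hr])]
  have hre := hsum (Q.aroots ℂ) (aroots_ne_zero_of_natDegree_pos (by omega))
    fun r hr => hQ.re_lt_zero_of_mem_aroots hr
  rw [nextCoeff_map (algebraMap ℚ ℂ).injective, nextCoeff_of_natDegree_pos (by omega),
    leadingCoeff_map, leadingCoeff, hn, Nat.add_sub_cancel] at h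
  have h' := congrArg Complex.re h
  simp only [eq_ratCast, Complex.ratCast_re, neg_mul, Complex.neg_re, Complex.mul_re,
    Complex.ratCast_im, zero_mul, sub_zero] at h'
  have hl' : (0 : ℝ) < Q.coeff (n + 1) := by exact_mod_cast hl
  have h'' : (0 : ℝ) < Q.coeff n := by
    rw [h', neg_pos]
    exact mul_neg_of_pos_of_neg hl' hre
  exact_mod_cast h''

/-! ### One step of the Stieltjes continued fraction -/

open Filter Topology in
/-- A minimum principle: if a proper rational function `P / B`, holomorphic in the right
half-plane, has real part at least `-d * z.re` there, then its real part is nonnegative there. -/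
theorem re_div_nonneg_of_neg_mul_re_le {P B : ℚ[X]} {d : ℝ} (hd : 0 < d)
    (hdeg : P.degree < B.degree) (hB : ∀ z : ℂ, 0 < z.re → aeval z B ≠ 0)
    (h : ∀ z : ℂ, 0 < z.re → -d * z.re ≤ (aeval z P / aeval z B).re) {w : ℂ} (hw : 0 < w.re) :
    0 ≤ (aeval w P / aeval w B).re := by
  -- The bound on the line `re z = ε` extends to the half-plane to the right of this line.
  have key : ∀ ε : ℝ, 0 < ε → ∀ z : ℂ, 0 ≤ z.re →
      -(aeval (z + ε) P / aeval (z + ε) B).re ≤ d * ε := by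
    intro ε hε z hz
    set g : ℂ → ℂ := fun z => Complex.exp (-(aeval (z + ε) P / aeval (z + ε) B)) with hg
    have hng : ∀ z, ‖g z‖ = Real.exp (-(aeval (z + ε) P / aeval (z + ε) B).re) := fun z => by
      rw [hg, Complex.norm_exp, Complex.neg_re]
    have hre : ∀ z : ℂ, 0 ≤ z.re → 0 < (z + ε).re := fun z hz => by
      rw [Complex.add_re, Complex.ofReal_re]; linarith
    have hbound : ∀ z : ℂ, 0 ≤ z.re → ‖g z‖ ≤ Real.exp (d * (z.re + ε)) := fun z hz => by
      rw [hng, Real.exp_le_exp]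
      have := h _ (hre z hz)
      rw [Complex.add_re z, Complex.ofReal_re] at this
      linarith
    rw [← Real.exp_le_exp, ← hng]
    refine PhragmenLindelof.right_half_plane_of_bounded_on_real (f := g) ?_ ⟨1, by norm_num, d, ?_⟩
      ?_ ?_ hz
    · refine DifferentiableOn.diffContOnCl fun z hz => ?_
      rw [Complex.closure_setOfPred_lt_re] at hz
      have hz' := hB _ (hre z hz)
      have d1 : ∀ Q : ℚ[X], DifferentiableAt ℂ (fun z : ℂ => aeval (z + (ε : ℂ)) Q) z := fun Q =>
        (Q.differentiable_aeval (𝕜 := ℂ) _).comp z (by fun_prop)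
      exact (((d1 P).div (d1 B) hz').neg.cexp).differentiableWithinAt
    · refine Asymptotics.IsBigO.of_bound (Real.exp (d * ε)) ?_
      filter_upwards [mem_inf_of_right (mem_principal_self _)] with z hz
      rw [Real.norm_of_nonneg (Real.exp_pos _).le, ← Real.exp_add, Real.rpow_one]
      refine (hbound z (le_of_lt hz)).trans (Real.exp_le_exp.2 ?_)
      nlinarith [Complex.re_le_norm z]
    · have ht := Polynomial.div_tendsto_atTop_zero_of_degree_lt (P.map (algebraMap ℚ ℝ))
        (B.map (algebraMap ℚ ℝ)) (by rwa [degree_map, degree_map])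
      have ht' := ht.comp (tendsto_atTop_add_const_right atTop ε tendsto_id)
      have hlim : Tendsto (fun x : ℝ => ‖g x‖) atTop (𝓝 (Real.exp (-0))) := by
        refine ((Real.continuous_exp.tendsto _).comp ht'.neg).congr fun x => ?_
        have e : ∀ Q : ℚ[X], aeval ((x : ℂ) + ε) Q =
            ((eval (x + ε) (Q.map (algebraMap ℚ ℝ)) : ℝ) : ℂ) := fun Q => by
          rw [eval_map_algebraMap, ← Complex.ofReal_add]
          exact aeval_algebraMap_apply ℂ (x + ε) Q
        rw [hng, e, e, ← Complex.ofReal_div, Complex.ofReal_re]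
        rfl
      exact hlim.isBoundedUnder_le
    · intro x
      refine (hbound _ (by simp)).trans (le_of_eq ?_)
      simp
  by_contra hneg
  set r := (aeval w P / aeval w B).re with hr
  have hε : 0 < min w.re (-r / (2 * d)) := lt_min hw (div_pos (by linarith) (by linarith))
  have := key _ hε (w - (min w.re (-r / (2 * d)) : ℝ))
    (by rw [Complex.sub_re, Complex.ofReal_re]; linarith [min_le_left w.re (-r / (2 * d))])
  rw [sub_add_cancel, ← hr] at this
  have h2 : d * min w.re (-r / (2 * d)) ≤ -r / 2 := by
    calc _ ≤ d * (-r / (2 * d)) := mul_le_mul_of_nonneg_left (min_le_right _ _) hd.le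
      _ = -r / 2 := by field_simp
  linarith

theorem re_pos_of_norm_sub_one_lt {w : ℂ} (h : ‖w - 1‖ < ‖w + 1‖) : 0 < w.re := by
  rw [← sq_lt_sq₀ (norm_nonneg _) (norm_nonneg _), Complex.sq_norm, Complex.sq_norm,
    Complex.normSq_apply, Complex.normSq_apply] at h
  simp at h
  nlinarith

/-- Division with remainder of the two parts of opposite parity preserves the Hurwitz property. In
the right half-plane `A / B` has positive real part, and by the minimum principle this persists for
`(A - d * X * B) / B`, up to equality; on the imaginary axis a root would be common to both
parts. -/
theorem IsHurwitz.add_sub_mul {A B : ℚ[X]} {n : ℕ} {d : ℚ}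
    (hA : A.comp (-X) = (-1) ^ (n + 1) * A) (hB : B.comp (-X) = (-1) ^ n * B)
    (hQ : (A + B).IsHurwitz) (hn : 0 < (A + B).natDegree) (hd : 0 < d)
    (hdeg : (A - C d * X * B).degree < B.degree) :
    (B + (A - C d * X * B)).IsHurwitz := by
  have hA' := aeval_neg_of_comp_neg_X hA
  have hB' := aeval_neg_of_comp_neg_X hB
  have hd' : (0 : ℝ) < d := by exact_mod_cast hd
  have hlt : ∀ z : ℂ, 0 < z.re → ‖aeval z A - aeval z B‖ < ‖aeval z A + aeval z B‖ := by
    intro z hz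
    have := hQ.norm_aeval_neg_lt hn hz
    have e : aeval (-z) (A + B) = (-1) ^ (n + 1) * (aeval z A - aeval z B) := by
      rw [map_add, hA', hB']; ring
    rwa [e, norm_mul, norm_pow, norm_neg, norm_one, one_pow, one_mul, map_add] at this
  have hB0 : ∀ z : ℂ, 0 < z.re → aeval z B ≠ 0 := by
    intro z hz h0
    have := hlt z hz
    simp [h0] at this
  have hR : ∀ z : ℂ, aeval z (A - C d * X * B) = aeval z A - d * z * aeval z B := fun z => by
    simp
  have hpos : ∀ z : ℂ, 0 < z.re →
      -(d : ℝ) * z.re ≤ (aeval z (A - C d * X * B) / aeval z B).re := by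
    intro z hz
    have h0 := hB0 z hz
    have h1 : ‖aeval z A / aeval z B - 1‖ < ‖aeval z A / aeval z B + 1‖ := by
      rw [div_sub_one h0, div_add_one h0, norm_div, norm_div]
      exact div_lt_div_of_pos_right (hlt z hz) (norm_pos_iff.2 h0)
    have h2 := re_pos_of_norm_sub_one_lt h1
    have h3 : aeval z (A - C d * X * B) / aeval z B = aeval z A / aeval z B - (d : ℝ) * z := by
      rw [hR, sub_div, mul_div_cancel_right₀ _ h0, Complex.ofReal_ratCast]
    rw [h3, Complex.sub_re, Complex.re_ofReal_mul]
    linarith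
  intro z hz
  by_contra hre
  rcases (not_lt.1 hre).lt_or_eq with hre | hre
  · have h1 := re_div_nonneg_of_neg_mul_re_le hd' hdeg hB0 hpos hre
    rw [map_add, add_comm, add_eq_zero_iff_eq_neg] at hz
    rw [hz, neg_div, div_self (hB0 z hre)] at h1
    norm_num at h1
  · -- The root lies on the imaginary axis, so its negative is a root, too.
    have hconj : starRingEnd ℂ z = -z := Complex.ext (by simp [← hre]) (by simp)
    have h1 := aeval_conj_rat (B + (A - C d * X * B)) z
    rw [hz, map_zero, hconj, map_add, hR, hA', hB'] at h1
    rw [map_add, hR] at hz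
    have h2 : (-1 : ℂ) ^ n * (aeval z B - (aeval z A - d * z * aeval z B)) = 0 := by
      rw [← h1]; ring
    have h3 := (mul_eq_zero.1 h2).resolve_left (pow_ne_zero _ (by norm_num))
    have h4 : aeval z B = 0 := by linear_combination (hz + h3) / 2
    have h5 : aeval z A = 0 := by
      rw [h4] at hz
      linear_combination hz
    have := hQ z (by rw [map_add, h4, h5, add_zero])
    linarith

/-! ### The continued fraction of a Hurwitz polynomial -/

theorem _root_.contFrac_pos {x : ℝ} (hx : 0 < x) :
    ∀ {d : List ℚ}, d ≠ [] → (∀ q ∈ d, 0 < q) → 0 < contFrac x d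
  | [], h, _ => absurd rfl h
  | [q], _, hd => mul_pos (by exact_mod_cast hd q (by simp)) hx
  | q :: e :: l, _, hd => by
    have hq : (0 : ℝ) < q := by exact_mod_cast hd q (by simp)
    rw [contFrac]
    exact add_pos (mul_pos hq hx) (one_div_pos.2 (contFrac_pos hx (List.cons_ne_nil e l)
      fun y hy => hd y (List.mem_cons_of_mem _ hy)))

/-- If `A` has the parity of its degree `n + 1` and `B` the opposite one, and if `A + B` is a
Hurwitz polynomial, then the Euclidean algorithm expands `A / B` into a continued fraction with
positive coefficients. -/
theorem IsHurwitz.exists_contFrac (n : ℕ) : ∀ {A B : ℚ[X]},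
    A.comp (-X) = (-1) ^ (n + 1) * A → B.comp (-X) = (-1) ^ n * B → A.natDegree = n + 1 →
    0 < A.coeff (n + 1) → B.natDegree ≤ n → (A + B).IsHurwitz →
    ∃ d : List ℚ, d ≠ [] ∧ (∀ q ∈ d, 0 < q) ∧
      ∀ x : ℝ, 0 < x → aeval x A = contFrac x d * aeval x B := by
  induction n with
  | zero =>
    intro A B hA hB hAn hApos hBn hQ
    have hsum : (A + B).natDegree = 0 + 1 := by
      rw [natDegree_add_eq_left_of_natDegree_lt (by omega), hAn]
    have hA0 := coeff_eq_zero_of_comp_neg_X hA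
    have hb : 0 < B.coeff 0 := by
      have := hQ.coeff_pos hsum (by
        rwa [coeff_add, coeff_eq_zero_of_natDegree_lt (p := B) (by omega), add_zero])
      rwa [coeff_add, hA0, zero_add] at this
    refine ⟨[A.coeff 1 / B.coeff 0], by simp, ?_, ?_⟩
    · simpa using div_pos hApos hb
    · intro x _
      have e₁ := eq_X_add_C_of_natDegree_le_one hAn.le
      have e₂ := eq_C_of_natDegree_le_zero hBn
      have hb' : (B.coeff 0 : ℝ) ≠ 0 := by exact_mod_cast hb.ne'
      have v₁ : aeval x A = A.coeff 1 * x := by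
        conv_lhs => rw [e₁, hA0]
        simp
      have v₂ : aeval x B = B.coeff 0 := by
        conv_lhs => rw [e₂]
        simp
      rw [v₁, v₂, contFrac]
      push_cast
      field_simp
  | succ n ih =>
    intro A B hA hB hAn hApos hBn hQ
    have hsum : (A + B).natDegree = n + 1 + 1 := by
      rw [natDegree_add_eq_left_of_natDegree_lt (by omega), hAn]
    have hA0 := coeff_eq_zero_of_comp_neg_X hA
    have hb : 0 < B.coeff (n + 1) := by
      have := hQ.coeff_pos hsum (by
        rwa [coeff_add, coeff_eq_zero_of_natDegree_lt (p := B) (by omega), add_zero])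
      rwa [coeff_add, hA0, zero_add] at this
    have hBn' : B.natDegree = n + 1 := le_antisymm hBn (le_natDegree_of_ne_zero hb.ne')
    set d := A.coeff (n + 1 + 1) / B.coeff (n + 1) with hd
    have hdpos : 0 < d := div_pos hApos hb
    set R := A - C d * X * B with hRdef
    have hRcoeff : ∀ k, n + 1 ≤ k → R.coeff k = 0 := by
      intro k hk
      obtain ⟨j, rfl⟩ : ∃ j, k = j + 1 := ⟨k - 1, by omega⟩
      rw [hRdef, coeff_sub, mul_assoc, coeff_C_mul, coeff_X_mul]
      rcases (show j = n ∨ j = n + 1 ∨ n + 1 < j by omega) with rfl | rfl | hj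
      · rw [hA0, coeff_eq_zero_of_comp_neg_X hB, mul_zero, sub_zero]
      · rw [hd, div_mul_cancel₀ _ hb.ne', sub_self]
      · rw [coeff_eq_zero_of_natDegree_lt (p := A) (by omega),
          coeff_eq_zero_of_natDegree_lt (p := B) (by omega), mul_zero, sub_zero]
    have hRdeg : R.degree < B.degree := by
      rw [degree_eq_natDegree (p := B) (by rintro rfl; simp at hb), hBn']
      exact (degree_lt_iff_coeff_zero _ _).2 hRcoeff
    have hRcomp : R.comp (-X) = (-1) ^ n * R := by
      rw [hRdef, sub_comp, mul_comp, mul_comp, C_comp, X_comp, hA, hB]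
      ring
    obtain ⟨l, hl, hlpos, hlx⟩ := ih hB hRcomp hBn' hb
      (natDegree_le_iff_coeff_eq_zero.2 fun k hk => hRcoeff k hk)
      (hQ.add_sub_mul hA hB (by omega) hdpos hRdeg)
    refine ⟨d :: l, by simp, by simpa [hdpos] using hlpos, fun x hx => ?_⟩
    have hcf := contFrac_pos hx hl hlpos
    have hx' := hlx x hx
    have hAx : aeval x A = d * x * aeval x B + aeval x R := by
      rw [hRdef]; simp
    obtain ⟨e, l', rfl⟩ := List.exists_cons_of_ne_nil hl
    rw [contFrac, hAx, hx']
    field_simp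

end Polynomial

open Polynomial in
theorem exists_contFrac_eq_one {c : ℝ} (hc : 0 < c) (halg : IsAlgebraic ℚ c)
    (hre : ∀ z : ℂ, aeval z (minpoly ℚ c) = 0 → 0 < z.re) :
    ∃ d : List ℚ, d ≠ [] ∧ (∀ q ∈ d, 0 < q) ∧ contFrac c d = 1 := by
  have hint := halg.isIntegral
  set P := minpoly ℚ c with hP
  have hmonic : P.Monic := minpoly.monic hint
  obtain ⟨n, hn⟩ : ∃ n, P.natDegree = n + 1 :=
    Nat.exists_eq_succ_of_ne_zero (minpoly.natDegree_pos hint).ne'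
  -- `Q` is the monic polynomial whose roots are the negatives of the conjugates of `c`.
  set Q : ℚ[X] := (-1) ^ (n + 1) * P.comp (-X) with hQ
  have hs : ((-1 : ℚ[X]) ^ (n + 1)) * (-1) ^ (n + 1) = 1 := by
    rw [← mul_pow]; simp
  have hQP : Q.comp (-X) = (-1) ^ (n + 1) * P := by
    rw [hQ, mul_comp, comp_assoc]
    simp
  have hPQ : P.comp (-X) = (-1) ^ (n + 1) * Q := by
    rw [hQ, ← mul_assoc, hs, one_mul]
  have hQcoeff : ∀ k, Q.coeff k = (-1) ^ (n + 1) * ((-1) ^ k * P.coeff k) := fun k => by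
    rw [hQ, show (-1 : ℚ[X]) ^ (n + 1) = C ((-1) ^ (n + 1)) by simp, coeff_C_mul,
      coeff_comp_neg_X]
  have hPlead : P.coeff (n + 1) = 1 := by rw [← hn]; exact hmonic
  have hQlead : Q.coeff (n + 1) = 1 := by
    rw [hQcoeff, hPlead, mul_one, ← mul_pow]; simp
  have hPbig : ∀ k, n + 1 < k → P.coeff k = 0 := fun k hk =>
    coeff_eq_zero_of_natDegree_lt (by omega)
  have hQbig : ∀ k, n + 1 < k → Q.coeff k = 0 := fun k hk => by rw [hQcoeff, hPbig k hk]; simp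
  have hQH : Q.IsHurwitz := by
    intro z hz
    have e : aeval z Q = (-1) ^ (n + 1) * aeval (-z) P := by
      rw [hQ]; simp [aeval_comp]
    rw [e] at hz
    have := hre _ ((mul_eq_zero.1 hz).resolve_left (pow_ne_zero _ (by norm_num)))
    simpa using this
  set A : ℚ[X] := C (1 / 2) * (Q + P) with hA
  set B : ℚ[X] := C (1 / 2) * (Q - P) with hB
  have hC : (C (1 / 2) : ℚ[X]) + C (1 / 2) = 1 := by
    rw [← C_add]; norm_num
  have hAB : A + B = Q := by
    rw [hA, hB]; linear_combination Q * hC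
  have hAcoeff : A.coeff (n + 1) = 1 := by
    rw [hA, coeff_C_mul, coeff_add, hPlead, hQlead]; norm_num
  have hAdeg : A.natDegree = n + 1 := by
    refine le_antisymm (natDegree_le_iff_coeff_eq_zero.2 fun k hk => ?_)
      (le_natDegree_of_ne_zero (by rw [hAcoeff]; exact one_ne_zero))
    rw [hA, coeff_C_mul, coeff_add, hPbig k hk, hQbig k hk]; simp
  have hBdeg : B.natDegree ≤ n := by
    refine natDegree_le_iff_coeff_eq_zero.2 fun k hk => ?_
    rw [hB, coeff_C_mul, coeff_sub]
    rcases (show k = n + 1 ∨ n + 1 < k by omega) with rfl | hk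
    · rw [hPlead, hQlead]; simp
    · rw [hPbig k hk, hQbig k hk]; simp
  obtain ⟨d, hd, hdpos, hdx⟩ := IsHurwitz.exists_contFrac n (A := A) (B := B)
    (by rw [hA, mul_comp, add_comp, C_comp, hQP, hPQ]; ring)
    (by rw [hB, mul_comp, sub_comp, C_comp, hQP, hPQ]; ring) hAdeg (by rw [hAcoeff]; exact one_pos)
    hBdeg (by rwa [hAB])
  refine ⟨d, hd, hdpos, ?_⟩
  have hPc : aeval c P = 0 := minpoly.aeval ℚ c
  have hQc : aeval c Q ≠ 0 := by
    intro h0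
    have : aeval (c : ℂ) Q = 0 := by
      have := aeval_algebraMap_apply ℂ c Q
      rw [h0, map_zero] at this
      exact this
    have := hQH _ this
    rw [Complex.ofReal_re] at this
    linarith
  have hx := hdx c hc
  rw [hA, hB, map_mul, map_mul, map_add, map_sub, hPc, add_zero, sub_zero] at hx
  have h0 : aeval c (C (1 / 2) : ℚ[X]) * aeval c Q ≠ 0 := by
    refine mul_ne_zero ?_ hQc
    simp
  exact (mul_right_cancel₀ h0 (by rw [one_mul]; exact hx)).symm

theorem theorem3 (c : ℝ) (hc : 0 < c) :
    List.TFAE [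
      ∃ S : Rect, S.IsSquare ∧ S.CanBeTiledByRatios {c, 1 / c},
      IsAlgebraic ℚ c ∧ ∀ z : ℂ, Polynomial.aeval z (minpoly ℚ c) = 0 → 0 < z.re,
      ∃ d : List ℚ, d ≠ [] ∧ (∀ q ∈ d, 0 < q) ∧ contFrac c d = 1] := by
  tfae_have 1 → 2 := fun ⟨_, hS, hT⟩ =>
    ⟨Rect.isAlgebraic_of_isTiling hc hS hT,
      fun _ hz => Rect.re_pos_of_aeval_minpoly_eq_zero hc hS hT hz⟩
  tfae_have 2 → 3 := fun ⟨halg, hre⟩ => exists_contFrac_eq_one hc halg hre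
  tfae_have 3 → 1 := fun ⟨_, hd, hpos, h⟩ => Rect.exists_isSquare_canBeTiledByRatios hc hd hpos h
  tfae_finish
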